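/- Let $E$ be a real Hausdorff locally convex topological vector space with topological dual $E'$, and let $C\subseteq E$ be a convex cone with $0\in C$ that is proper, i.e. $C\cap(-C)=\{0\}$, with $C\neq\{0\}$, and weakly complete, i.e. complete for the uniform structure of the weak topology of $E$. Let $G$ be a countable group with a representation on $C$, i.e. $G$ acts on $E$ by continuous linear maps with $gC\subseteq C$ for all $g\in G$. Equip $E'$ with the dual action $(g\varphi)(x)=\varphi(g^{-1}x)$ and the dual pre-order: $\lambda\le\mu$ if and only if $\lambda(x)\le\mu(x)$ for all $x\in C$. Assume that the representation is of cobounded type: there is $\varphi\in E'$ such that for every $\lambda\in E'$ there exist finitely many $g_1,\dots,g_n\in G$ with $\lambda\le\sum_i g_i\varphi$ and $-\lambda\le\sum_i g_i\varphi$. Assume moreover that the representation is equicontinuous on $E$, i.e. the family of maps $x\mapsto gx$ $(g\in G)$ is equicontinuous. Then $G$ fixes a non-zero point of $C$: there is $x\in C$ with $x\neq 0$ and $gx=x$ for all $g\in G$. -/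

import Mathlib

/-- A representation of `G` on `E` by continuous linear maps is a representation on the cone `C`
if every group element preserves the vector pre-order defined by `C`, i.e. maps `C` into `C`. -/
def PreservesCone {G E : Type*} [Group G] [AddCommGroup E] [Module ℝ E] [TopologicalSpace E]
    (ρ : G →* (E →L[ℝ] E)) (C : PointedCone ℝ E) : Prop :=
  ∀ g : G, ∀ x ∈ C, ρ g x ∈ C

/-- The pre-order on the topological dual `E'` dual to the pre-order on `E` with positive
cone `C`. -/
def DualLE {E : Type*} [AddCommGroup E] [Module ℝ E] [TopologicalSpace E]
    (C : PointedCone ℝ E) (lam mu : StrongDual ℝ E) : Prop :=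
  ∀ x ∈ C, lam x ≤ mu x

/-- The dual (contragredient) action of `G` on `E'`: `(g φ)(x) = φ (g⁻¹ x)`. -/
def dualAct {G E : Type*} [Group G] [AddCommGroup E] [Module ℝ E] [TopologicalSpace E]
    (ρ : G →* (E →L[ℝ] E)) (g : G) (φ : StrongDual ℝ E) : StrongDual ℝ E :=
  φ.comp (ρ g⁻¹)

/-- `φ` `G`-dominates `lam` in `E'`: there are `g₁, …, gₙ ∈ G` with `± lam ≤ ∑ gᵢ φ` for the dual
pre-order. -/
def GDominates {G E : Type*} [Group G] [AddCommGroup E] [Module ℝ E] [TopologicalSpace E]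
    (ρ : G →* (E →L[ℝ] E)) (C : PointedCone ℝ E) (φ lam : StrongDual ℝ E) : Prop :=
  ∃ (n : ℕ) (g : Fin n → G),
    DualLE C lam (∑ i, dualAct ρ (g i) φ) ∧ DualLE C (-lam) (∑ i, dualAct ρ (g i) φ)

/-- The representation is of cobounded type: some continuous linear form `G`-dominates every
continuous linear form. -/
def IsCoboundedType {G E : Type*} [Group G] [AddCommGroup E] [Module ℝ E] [TopologicalSpace E]
    (ρ : G →* (E →L[ℝ] E)) (C : PointedCone ℝ E) : Prop :=
  ∃ φ : StrongDual ℝ E, ∀ lam : StrongDual ℝ E, GDominates ρ C φ lam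

/-- A subset of `E` is weakly complete if it is complete (every Cauchy filter on it converges in
it) for the translation-invariant uniform structure of the weak topology of `E`. -/
def IsWeaklyComplete {E : Type*} [AddCommGroup E] [Module ℝ E] [TopologicalSpace E]
    (S : Set E) : Prop :=
  @IsComplete (WeakSpace ℝ E) (IsTopologicalAddGroup.rightUniformSpace (WeakSpace ℝ E))
    (toWeakSpace ℝ E '' S)

/-! A fixed point is found in a weakly compact convex invariant subset of `C` avoiding 0.
Coboundedness gives a positive `ψ` whose translates dominate every functional on `C`. Averaging
these translates with summable positive weights gives one functional `Φ`, continuous by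
equicontinuity (`exists_average_strongDual`), that dominates every functional on `C` up to a
constant. So `Φ` is strictly positive on `C \ {0}`, and by weak completeness its sublevel sets in
`C` are weakly compact.

A gliding hump argument (`exists_forall_le_mul_of_isCompact`) bounds all translates of `ψ` by one
multiple of `Φ`, whence `Φ (g x) ≤ M * Φ x` on `C` for all `g`. The points of `C` on whose whole
orbit `Φ` stays between `M⁻¹ * Φ x₀` and `M * Φ x₀` form the required set.

The fixed point itself comes from Ryll-Nardzewski (`exists_fixed_point_of_isCompact_weak`): a
minimal compact convex invariant set is norm-separable because `G` is countable, so Baire category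
and a Chebyshev-centre argument give it diameter zero for each invariant continuous seminorm. -/

open Set Filter Topology in
/-- In a Hausdorff space, a property of sets which is stable under arbitrary intersections has a
minimal nonempty compact representative below any given one. -/
theorem IsCompact.exists_minimal_nonempty_of_sInter {X : Type*} [TopologicalSpace X] [T2Space X]
    {P : Set X → Prop} (hP : ∀ c : Set (Set X), (∀ s ∈ c, P s) → P (⋂₀ c)) {K : Set X}
    (hK : IsCompact K) (hne : K.Nonempty) (hPK : P K) :
    ∃ Z ⊆ K, Z.Nonempty ∧ IsCompact Z ∧ P Z ∧
      ∀ Y ⊆ Z, Y.Nonempty → IsClosed Y → P Y → Y = Z := by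
  obtain ⟨Z, hZK, hZ⟩ := zorn_superset_nonempty
    {s : Set X | s.Nonempty ∧ IsCompact s ∧ P s}
    (by
      intro c hc hchain hcne
      refine ⟨⋂₀ c, ⟨?_, ?_, hP c fun s hs => (hc hs).2.2⟩, fun s hs => sInter_subset_of_mem hs⟩
      · have : Nonempty c := hcne.to_subtype
        rw [sInter_eq_iInter]
        exact IsCompact.nonempty_iInter_of_directed_nonempty_isCompact_isClosed
          (fun s : c => (s : Set X))
          (by
            intro s t
            rcases hchain.total s.2 t.2 with h | h
            · exact ⟨s, subset_rfl, h⟩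
            · exact ⟨t, h, subset_rfl⟩)
          (fun s => (hc s.2).1) (fun s => (hc s.2).2.1) (fun s => (hc s.2).2.1.isClosed)
      · obtain ⟨s, hs⟩ := hcne
        exact (hc hs).2.1.of_isClosed_subset
          (isClosed_sInter fun t ht => (hc ht).2.1.isClosed) (sInter_subset_of_mem hs))
    K ⟨hne, hK, hPK⟩
  refine ⟨Z, hZK, hZ.prop.1, hZ.prop.2.1, hZ.prop.2.2, fun Y hYZ hY hYc hPY => ?_⟩
  exact hYZ.antisymm (hZ.le_of_le ⟨hY, hZ.prop.2.1.of_isClosed_subset hYc hYZ, hPY⟩ hYZ)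

theorem Seminorm.convex_setOf_sub_le {X : Type*} [AddCommGroup X] [Module ℝ X] (p : Seminorm ℝ X) (a : X) (r : ℝ) :
    Convex ℝ {x | p (x - a) ≤ r} := by
  convert p.convex_closedBall a r using 1
  ext x
  simp [Seminorm.mem_closedBall]

/-! ### Minimal invariant sets and invariant seminorms -/

section InvariantSeminorm

open Set Filter Topology

variable {G X : Type*} [Group G] [AddCommGroup X] [Module ℝ X] [TopologicalSpace X]
  [IsTopologicalAddGroup X]

theorem Seminorm.isClosed_setOf_sub_le {p : Seminorm ℝ X} (hp : ∀ r, IsClosed {x | p x ≤ r})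
    (a : X) (r : ℝ) : IsClosed {x | p (x - a) ≤ r} :=
  (hp r).preimage (continuous_id.sub continuous_const)

/-- A minimal compact invariant set which is separable for an invariant seminorm with closed balls
is totally bounded for this seminorm. -/
theorem exists_finite_net_of_minimal [T2Space X] (T : G →* (X →L[ℝ] X)) {p : Seminorm ℝ X}
    (hp : ∀ r, IsClosed {x | p x ≤ r}) (hpT : ∀ g x, p (T g x) = p x) {Z : Set X}
    (hZne : Z.Nonempty) (hZ : IsCompact Z) (hZT : ∀ g, MapsTo (T g) Z Z)
    (hmin : ∀ Y ⊆ Z, Y.Nonempty → IsClosed Y → (∀ g, MapsTo (T g) Y Y) → Y = Z)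
    {ε : ℝ} {D : Set X} (hD : D.Countable) (hDZ : ∀ z ∈ Z, ∃ d ∈ D, p (z - d) ≤ ε) :
    ∃ F : Finset X, ↑F ⊆ Z ∧ ∀ z ∈ Z, ∃ f ∈ F, p (z - f) ≤ 2 * ε := by
  classical
  have : CompactSpace Z := isCompact_iff_compactSpace.1 hZ
  have : Nonempty Z := hZne.to_subtype
  have : Countable D := hD.to_subtype
  -- Baire category in the compact space `Z`: one of countably many closed balls has interior.
  obtain ⟨d, hd⟩ := nonempty_interior_of_iUnion_of_closed
    (f := fun d : D => {z : Z | p ((z : X) - d) ≤ ε})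
    (fun d => (Seminorm.isClosed_setOf_sub_le hp (d : X) ε).preimage continuous_subtype_val)
    (eq_univ_of_forall fun z => by
      obtain ⟨d, hd, h⟩ := hDZ z z.2
      exact mem_iUnion.2 ⟨⟨d, hd⟩, h⟩)
  obtain ⟨w, hw⟩ := hd
  obtain ⟨W, hW, hWeq⟩ := isOpen_induced_iff.1
    (isOpen_interior (s := {z : Z | p ((z : X) - d) ≤ ε}))
  have hWd : ∀ z ∈ Z, z ∈ W → p (z - d) ≤ ε := fun z hz hzW => by
    have : (⟨z, hz⟩ : Z) ∈ interior {z : Z | p ((z : X) - d) ≤ ε} := by rw [← hWeq]; exact hzW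
    exact (interior_subset this : _ ∈ {z : Z | p ((z : X) - d) ≤ ε})
  have hwW : (w : X) ∈ W := by rw [← hWeq] at hw; exact hw
  -- Points whose orbit avoids `W` form a closed invariant set missing `w`, so minimality makes it
  -- empty.
  have hcover : ∀ z ∈ Z, ∃ g, T g z ∈ W := by
    by_contra! h
    obtain ⟨z, hz, hzW⟩ := h
    have hY := hmin {y | y ∈ Z ∧ ∀ g, T g y ∉ W} (fun y hy => hy.1) ⟨z, hz, hzW⟩
      (by
        have : {y | y ∈ Z ∧ ∀ g, T g y ∉ W} = Z ∩ ⋂ g, (T g) ⁻¹' Wᶜ := by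
          ext y; simp
        rw [this]
        exact hZ.isClosed.inter
          (isClosed_iInter fun g => hW.isClosed_compl.preimage (T g).continuous))
      (fun g y hy => ⟨hZT g hy.1, fun h => by
        have := hy.2 (h * g)
        rwa [map_mul] at this⟩)
    have hwY : (w : X) ∈ {y | y ∈ Z ∧ ∀ g, T g y ∉ W} := by rw [hY]; exact w.2
    have := hwY.2 1
    rw [map_one] at this
    exact this hwW
  obtain ⟨t, ht⟩ := hZ.elim_finite_subcover (fun g => (T g) ⁻¹' W)
    (fun g => hW.preimage (T g).continuous)
    (fun z hz => mem_iUnion.2 (hcover z hz))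
  refine ⟨t.image fun g => T g⁻¹ w, ?_, fun z hz => ?_⟩
  · intro y hy
    obtain ⟨g, -, rfl⟩ := Finset.mem_image.1 (Finset.mem_coe.1 hy)
    exact hZT _ w.2
  · obtain ⟨g, hg, hgz⟩ := mem_iUnion₂.1 (ht hz)
    refine ⟨T g⁻¹ w, Finset.mem_image_of_mem _ hg, ?_⟩
    have h1 : T g (T g⁻¹ w) = (w : X) := by
      rw [← mul_apply_eq_comp, ← map_mul, mul_inv_cancel, map_one]; rfl
    rw [← hpT g, map_sub, h1]
    have h2 := hWd _ (hZT g hz) hgz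
    have h3 := hWd _ w.2 hwW
    have h4 : T g z - (w : X) = (T g z - d) - (w - d) := by abel
    rw [h4]
    linarith [map_sub_le_add p (T g z - d) ((w : X) - d)]

theorem mapsTo_closure_convexHull (T : G →* (X →L[ℝ] X)) {Z : Set X}
    (hZT : ∀ g, MapsTo (T g) Z Z) (g : G) :
    MapsTo (T g) (closure (convexHull ℝ Z)) (closure (convexHull ℝ Z)) := by
  refine MapsTo.closure ?_ (T g).continuous
  intro x hx
  have h : T g x ∈ (T g : X →ₗ[ℝ] X) '' convexHull ℝ Z := ⟨x, hx, rfl⟩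
  rw [LinearMap.image_convexHull] at h
  exact convexHull_mono (image_subset_iff.2 (hZT g)) h

/-- A minimal compact convex invariant set which is separable for an invariant seminorm with closed
balls has diameter zero for this seminorm. -/
theorem seminorm_sub_eq_zero_of_minimal [T2Space X] [ContinuousSMul ℝ X] (T : G →* (X →L[ℝ] X)) {p : Seminorm ℝ X}
    (hp : ∀ r, IsClosed {x | p x ≤ r}) (hpT : ∀ g x, p (T g x) = p x) {K : Set X}
    (hKne : K.Nonempty) (hK : IsCompact K) (hKconv : Convex ℝ K) (hKT : ∀ g, MapsTo (T g) K K)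
    (hmin : ∀ Y ⊆ K, Y.Nonempty → IsClosed Y → (Convex ℝ Y ∧ ∀ g, MapsTo (T g) Y Y) → Y = K)
    (hsep : ∀ ε > 0, ∃ D : Set X, D.Countable ∧ ∀ z ∈ K, ∃ d ∈ D, p (z - d) ≤ ε)
    {x y : X} (hx : x ∈ K) (hy : y ∈ K) : p (x - y) = 0 := by
  -- The Baire argument needs minimality among all closed invariant sets, convex or not; hence a
  -- second minimal set inside `K`.
  obtain ⟨Z, hZK, hZne, hZ, hZT, hZmin⟩ :=
    hK.exists_minimal_nonempty_of_sInter (P := fun s => ∀ g, MapsTo (T g) s s)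
      (fun c hc g z hz s hs => hc s hs g (hz s hs)) hKne hKT
  have hnet : ∀ ε > 0, ∃ F : Finset X, ↑F ⊆ Z ∧ ∀ z ∈ Z, ∃ f ∈ F, p (z - f) ≤ 2 * ε := by
    intro ε hε
    obtain ⟨D, hD, hDK⟩ := hsep ε hε
    exact exists_finite_net_of_minimal T hp hpT hZne hZ hZT hZmin hD fun z hz => hDK z (hZK hz)
  have hull : closure (convexHull ℝ Z) = K :=
    hmin _ (closure_minimal (convexHull_min hZK hKconv) hK.isClosed)
      (hZne.mono ((subset_convexHull ℝ Z).trans subset_closure)) isClosed_closure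
      ⟨(convex_convexHull ℝ Z).closure, mapsTo_closure_convexHull T hZT⟩
  have hext : ∀ (b : X) (r : ℝ), (∀ z ∈ Z, p (z - b) ≤ r) → ∀ z ∈ K, p (z - b) ≤ r := by
    intro b r h z hz
    rw [← hull] at hz
    exact closure_minimal (convexHull_min h (p.convex_setOf_sub_le b r))
      (Seminorm.isClosed_setOf_sub_le hp b r) hz
  -- the diameter of `Z`
  set S : Set ℝ := {r | ∃ u ∈ Z, ∃ v ∈ Z, p (u - v) = r} with hS
  have hSbdd : BddAbove S := by
    obtain ⟨F, hFZ, hF⟩ := hnet 1 one_pos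
    obtain ⟨B, hB⟩ := (F.image p).bddAbove
    have hZB : ∀ z ∈ Z, p z ≤ B + 2 := by
      intro z hz
      obtain ⟨f, hf, hzf⟩ := hF z hz
      have h1 : p f ≤ B := hB (by simpa using ⟨f, hf, rfl⟩)
      have h2 := map_add_le_add p (z - f) f
      rw [sub_add_cancel] at h2
      linarith
    refine ⟨2 * (B + 2), ?_⟩
    rintro _ ⟨u, hu, v, hv, rfl⟩
    linarith [map_sub_le_add p u v, hZB u hu, hZB v hv]
  obtain ⟨z₀, hz₀⟩ := hZne
  have hdiam : ∀ u ∈ Z, ∀ v ∈ Z, p (u - v) ≤ sSup S := fun u hu v hv =>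
    le_csSup hSbdd ⟨u, hu, v, hv, rfl⟩
  set d := sSup S with hd
  have hd0 : d ≤ 0 := by
    by_contra! hdpos
    -- Each point of `Z` is within `d / 2` of one net point and within `d` of the others, so the
    -- barycentre of the net is strictly closer than `d` to all of `Z`.
    obtain ⟨F, hFZ, hF⟩ := hnet (d / 4) (by positivity)
    have hFne : F.Nonempty := by
      obtain ⟨f, hf, -⟩ := hF z₀ hz₀
      exact ⟨f, hf⟩
    have hn : 0 < (F.card : ℝ) := by exact_mod_cast hFne.card_pos
    set b : X := (F.card : ℝ)⁻¹ • ∑ f ∈ F, f with hb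
    set r : ℝ := d - d / (2 * F.card) with hr
    have hrd : r < d := by
      have : 0 < d / (2 * F.card) := by positivity
      linarith
    have hbZ : ∀ z ∈ Z, p (z - b) ≤ r := by
      intro z hz
      obtain ⟨f, hf, hzf⟩ := hF z hz
      have h1 : z - b = (F.card : ℝ)⁻¹ • ∑ f ∈ F, (z - f) := by
        rw [Finset.sum_sub_distrib, Finset.sum_const, smul_sub, ← hb,
          ← Nat.cast_smul_eq_nsmul ℝ, smul_smul, inv_mul_cancel₀ hn.ne', one_smul]
      have h2 : p (∑ f ∈ F, (z - f)) ≤ ∑ f ∈ F, p (z - f) :=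
        Finset.le_sum_of_subadditive p (map_zero p).le (map_add_le_add p) _ _
      have h3 : ∑ f ∈ F, p (z - f) ≤ d / 2 + (F.card - 1) * d := by
        classical
        rw [← Finset.add_sum_erase _ _ hf]
        have h4 : ∑ f ∈ F.erase f, p (z - f) ≤ (F.erase f).card • d :=
          Finset.sum_le_card_nsmul _ _ _ fun u hu =>
            hdiam z hz u (hFZ (Finset.mem_of_mem_erase hu))
        rw [nsmul_eq_mul, Finset.cast_card_erase_of_mem hf] at h4
        linarith
      have h5 : r = (F.card : ℝ)⁻¹ * (d / 2 + (F.card - 1) * d) := by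
        rw [hr]; field_simp; ring
      rw [h1, map_smul_eq_mul, Real.norm_of_nonneg (by positivity), h5]
      exact mul_le_mul_of_nonneg_left (h2.trans h3) (by positivity)
    have hbK : b ∈ K := by
      rw [hb, Finset.smul_sum]
      exact hKconv.sum_mem (fun _ _ => by positivity)
        (by rw [Finset.sum_const, nsmul_eq_mul, mul_inv_cancel₀ hn.ne'])
        (fun f hf => hZK (hFZ hf))
    -- The Chebyshev centres of radius `r` form a closed convex invariant set containing `b`;
    -- minimality makes it all of `K`, so `Z` has diameter at most `r < d`.
    have hYK := hmin {u | u ∈ K ∧ ∀ v ∈ K, p (u - v) ≤ r} (fun u hu => hu.1)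
      ⟨b, hbK, fun v hv => by rw [map_sub_rev]; exact hext b r hbZ v hv⟩
      (by
        have : {u | u ∈ K ∧ ∀ v ∈ K, p (u - v) ≤ r} = K ∩ ⋂ v ∈ K, {u | p (u - v) ≤ r} := by
          ext u; simp
        rw [this]
        exact hK.isClosed.inter
          (isClosed_biInter fun v _ => Seminorm.isClosed_setOf_sub_le hp v r))
      ⟨by
        have : {u | u ∈ K ∧ ∀ v ∈ K, p (u - v) ≤ r} = K ∩ ⋂ v ∈ K, {u | p (u - v) ≤ r} := by
          ext u; simp
        rw [this]
        exact hKconv.inter (convex_iInter₂ fun v _ => p.convex_setOf_sub_le v r),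
      fun g u hu => ⟨hKT g hu.1, fun v hv => by
        have h1 : T g (T g⁻¹ v) = v := by
          rw [← mul_apply_eq_comp, ← map_mul, mul_inv_cancel, map_one]; rfl
        rw [← h1, ← map_sub, hpT]
        exact hu.2 _ (hKT _ hv)⟩⟩
    have hdr : d ≤ r := by
      refine csSup_le ⟨_, z₀, hz₀, z₀, hz₀, rfl⟩ ?_
      rintro _ ⟨u, hu, v, hv, rfl⟩
      have : u ∈ {u | u ∈ K ∧ ∀ v ∈ K, p (u - v) ≤ r} := by rw [hYK]; exact hZK hu
      exact this.2 v (hZK hv)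
    linarith
  refine le_antisymm (hext y 0 (fun u hu => ?_) x hx) (apply_nonneg p _)
  rw [map_sub_rev]
  exact hext u 0 (fun v hv => (hdiam v hv u hu).trans hd0) y hy

end InvariantSeminorm

/-! ### Weak topology and weak compactness -/

section WeakTopology

open Set Filter Topology

variable {E : Type*} [AddCommGroup E] [Module ℝ E] [TopologicalSpace E]

theorem WeakSpace.continuous_eval (φ : StrongDual ℝ E) :
    Continuous fun x : WeakSpace ℝ E => φ ((toWeakSpace ℝ E).symm x) :=
  WeakBilin.eval_continuous (topDualPairing ℝ E).flip φ

variable [IsTopologicalAddGroup E] [ContinuousSMul ℝ E] [LocallyConvexSpace ℝ E]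

/-- Mazur's theorem; it makes the balls of a continuous seminorm weakly closed. -/
theorem Convex.isClosed_image_toWeakSpace {s : Set E} (hs : Convex ℝ s) (hs' : IsClosed s) :
    IsClosed (toWeakSpace ℝ E '' s) := by
  rw [← hs'.closure_eq, hs.toWeakSpace_closure ℝ]
  exact isClosed_closure

theorem exists_strongDual_ne [T2Space E] {x y : E} (h : x ≠ y) :
    ∃ f : StrongDual ℝ E, f x ≠ f y := by
  obtain ⟨f, hf⟩ := geometric_hahn_banach_point_point h
  exact ⟨f, hf.ne⟩

theorem WeakSpace.t2Space [T2Space E] : T2Space (WeakSpace ℝ E) := by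
  refine ⟨fun x y hxy => ?_⟩
  obtain ⟨f, hf⟩ := exists_strongDual_ne
    (fun h => hxy ((toWeakSpace ℝ E).symm.injective h) :
      (toWeakSpace ℝ E).symm x ≠ (toWeakSpace ℝ E).symm y)
  exact separated_by_continuous (WeakSpace.continuous_eval f) hf

theorem WeakSpace.tendsto_iff [T2Space E] {α : Type*} {l : Filter α} {f : α → WeakSpace ℝ E}
    {x : WeakSpace ℝ E} :
    Tendsto f l (𝓝 x) ↔ ∀ φ : StrongDual ℝ E,
      Tendsto (fun i => φ ((toWeakSpace ℝ E).symm (f i))) l (𝓝 (φ ((toWeakSpace ℝ E).symm x))) := by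
  refine WeakBilin.tendsto_iff_forall_eval_tendsto (topDualPairing ℝ E).flip ?_
  intro x y h
  by_contra hne
  obtain ⟨f, hf⟩ := exists_strongDual_ne (E := E) hne
  exact hf (DFunLike.congr_fun h f)

/-- Subsets of a weakly complete set cut out by weakly closed conditions are weakly compact as soon
as every functional is bounded on them. -/
theorem IsWeaklyComplete.isCompact_image [T2Space E] {S K : Set E} (hS : IsWeaklyComplete S)
    (hKS : K ⊆ S) (hK : ∃ F : Set (WeakSpace ℝ E), IsClosed F ∧
      toWeakSpace ℝ E '' K = toWeakSpace ℝ E '' S ∩ F)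
    (hbdd : ∀ φ : StrongDual ℝ E, ∃ c, ∀ x ∈ K, |φ x| ≤ c) :
    IsCompact (toWeakSpace ℝ E '' K) := by
  obtain ⟨F, hF, hKF⟩ := hK
  rw [isCompact_iff_ultrafilter_le_nhds]
  intro 𝒰 h𝒰
  have hmem : toWeakSpace ℝ E '' K ∈ 𝒰 := le_principal_iff.1 h𝒰
  -- Boundedness makes each functional converge along the ultrafilter, which is therefore weakly
  -- Cauchy.
  have hlim : ∀ φ : StrongDual ℝ E, ∃ a,
      Tendsto (fun x : WeakSpace ℝ E => φ ((toWeakSpace ℝ E).symm x)) 𝒰 (𝓝 a) := by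
    intro φ
    obtain ⟨c, hc⟩ := hbdd φ
    obtain ⟨a, -, ha⟩ := (isCompact_Icc (a := -c) (b := c)).ultrafilter_le_nhds
      (𝒰.map fun x : WeakSpace ℝ E => φ ((toWeakSpace ℝ E).symm x))
      (le_principal_iff.2 (by
        rw [Ultrafilter.mem_coe, Ultrafilter.mem_map]
        refine mem_of_superset hmem ?_
        rintro _ ⟨x, hx, rfl⟩
        exact abs_le.1 (by simpa using hc x hx)))
    exact ⟨a, ha⟩
  have hcauchy : @Cauchy (WeakSpace ℝ E)
      (IsTopologicalAddGroup.rightUniformSpace (WeakSpace ℝ E)) 𝒰 := by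
    refine ⟨𝒰.neBot, ?_⟩
    change _ ≤ comap (fun p : WeakSpace ℝ E × WeakSpace ℝ E => p.2 + -p.1) (𝓝 0)
    rw [← tendsto_iff_comap, WeakSpace.tendsto_iff]
    intro φ
    obtain ⟨a, ha⟩ := hlim φ
    have h := (ha.comp (tendsto_snd (f := (𝒰 : Filter (WeakSpace ℝ E))))).sub
      (ha.comp (tendsto_fst (g := (𝒰 : Filter (WeakSpace ℝ E)))))
    rw [sub_self] at h
    simpa [Function.comp_def, sub_eq_add_neg] using h
  obtain ⟨x, hx, hxlim⟩ := hS 𝒰 hcauchy (h𝒰.trans (principal_mono.2 (image_mono hKS)))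
  have hxlim' : (𝒰 : Filter (WeakSpace ℝ E)) ≤ 𝓝 x := hxlim
  refine ⟨x, ?_, hxlim'⟩
  rw [hKF]
  refine ⟨hx, hF.mem_of_tendsto (tendsto_id'.2 hxlim') ?_⟩
  filter_upwards [hmem] with y hy
  rw [hKF] at hy
  exact hy.2

end WeakTopology

/-! ### Ryll-Nardzewski fixed point theorem -/

section RyllNardzewski

open Set Filter Topology

variable {G : Type*} [Group G] {E : Type*} [AddCommGroup E] [Module ℝ E]

/-- The action on the weak space induced by a representation by continuous linear maps. -/
def WeakSpace.mapHom [TopologicalSpace E] (ρ : G →* (E →L[ℝ] E)) :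
    G →* (WeakSpace ℝ E →L[ℝ] WeakSpace ℝ E) where
  toFun g := WeakSpace.map (ρ g)
  map_one' := by
    ext x
    simp only [map_one]
    rfl
  map_mul' g h := by
    ext x
    simp only [map_mul]
    rfl

variable [UniformSpace E] [IsUniformAddGroup E] [ContinuousSMul ℝ E] [LocallyConvexSpace ℝ E]

/-- An equicontinuous representation preserves a separating family of continuous seminorms. -/
theorem exists_invariant_seminorm_ne_zero [T2Space E] (ρ : G →* (E →L[ℝ] E))
    (hρ : Equicontinuous fun (g : G) (x : E) => ρ g x) {x : E} (hx : x ≠ 0) :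
    ∃ p : Seminorm ℝ E, Continuous p ∧ (∀ g y, p (ρ g y) = p y) ∧ p x ≠ 0 := by
  have hw : WithSeminorms (gaugeSeminormFamily ℝ E) := with_gaugeSeminormFamily
  obtain ⟨i, hi⟩ := hw.separating_of_T1 x hx
  have htfae := (hw.equicontinuous_TFAE fun g => (ρ g : E →ₗ[ℝ] E)).out 1 4
  obtain ⟨hb, hc⟩ := htfae.1 hρ i
  set q := gaugeSeminormFamily ℝ E i
  have happ : ∀ y, (⨆ g, q.comp (ρ g : E →ₗ[ℝ] E)) y = ⨆ g, q (ρ g y) := fun y =>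
    Seminorm.iSup_apply hb
  refine ⟨⨆ g, q.comp (ρ g : E →ₗ[ℝ] E), Seminorm.coe_iSup_eq hb ▸ hc, fun h y => ?_, ?_⟩
  · rw [happ, happ, ← (Equiv.mulRight h).iSup_comp (g := fun g => q (ρ g y))]
    simp only [Equiv.coe_mulRight, map_mul, mul_apply_eq_comp]
  · have h1 : q x ≤ ⨆ g, q (ρ g x) := by
      have := le_ciSup (Seminorm.bddAbove_range_iff.1 hb x) 1
      simpa using this
    rw [happ]
    exact ((lt_of_le_of_ne (apply_nonneg q x) hi.symm).trans_le h1).ne'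

/-- The Ryll-Nardzewski theorem for equicontinuous representations of countable groups. -/
theorem exists_fixed_point_of_isCompact_weak [Countable G] [T2Space E] (ρ : G →* (E →L[ℝ] E))
    (hρ : Equicontinuous fun (g : G) (x : E) => ρ g x) {K : Set E} (hKne : K.Nonempty)
    (hK : IsCompact (toWeakSpace ℝ E '' K)) (hKconv : Convex ℝ K)
    (hKρ : ∀ g, MapsTo (ρ g) K K) : ∃ x ∈ K, ∀ g, ρ g x = x := by
  have : T2Space (WeakSpace ℝ E) := WeakSpace.t2Space
  set T := WeakSpace.mapHom ρ with hT
  obtain ⟨Q, hQK, hQne, hQ, ⟨hQconv, hQT⟩, hmin⟩ :=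
    hK.exists_minimal_nonempty_of_sInter
      (P := fun s => Convex ℝ s ∧ ∀ g, MapsTo (T g) s s)
      (fun c hc => ⟨convex_sInter fun s hs => (hc s hs).1,
        fun g z hz s hs => (hc s hs).2 g (hz s hs)⟩)
      (hKne.image _)
      ⟨hKconv.linear_image (toWeakSpace ℝ E : E →ₗ[ℝ] WeakSpace ℝ E), by
        rintro g _ ⟨x, hx, rfl⟩
        exact ⟨ρ g x, hKρ g hx, rfl⟩⟩
  obtain ⟨z, hz⟩ := hQne
  obtain ⟨k, hk, rfl⟩ := hQK hz
  -- `Q` is separable in the original topology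
  have hsepE : TopologicalSpace.IsSeparable
      (closure (convexHull ℝ (range fun g => ρ g k))) :=
    ((countable_range fun g => ρ g k).isSeparable.span (R := ℝ) |>.mono
      (convexHull_min Submodule.subset_span (Submodule.convex _))).closure
  have hQsub : Q ⊆ toWeakSpace ℝ E '' closure (convexHull ℝ (range fun g => ρ g k)) := by
    -- By minimality `Q` is the weakly closed convex hull of one countable orbit; by convexity this
    -- is also the closure in the original topology.
    have h1 : closure (convexHull ℝ (range fun g => T g (toWeakSpace ℝ E k))) = Q :=
      hmin _ (closure_minimal (convexHull_min (by
          rintro _ ⟨g, rfl⟩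
          exact hQT g hz) hQconv) hQ.isClosed)
        ⟨_, subset_closure (subset_convexHull ℝ _ ⟨1, rfl⟩)⟩ isClosed_closure
        ⟨(convex_convexHull ℝ _).closure, mapsTo_closure_convexHull T (by
          rintro g _ ⟨h, rfl⟩
          exact ⟨g * h, by simp only [map_mul, mul_apply_eq_comp]⟩)⟩
    rw [← h1, (convex_convexHull ℝ _).toWeakSpace_closure ℝ]
    refine closure_mono ?_
    have h2 := LinearMap.image_convexHull (toWeakSpace ℝ E : E →ₗ[ℝ] WeakSpace ℝ E)
      (range fun g => ρ g k)
    rw [← range_comp] at h2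
    exact h2.ge
  refine ⟨k, hk, fun g => ?_⟩
  by_contra hne
  obtain ⟨p, hpc, hpρ, hp⟩ := exists_invariant_seminorm_ne_zero ρ hρ (sub_ne_zero.2 hne)
  refine hp ?_
  refine seminorm_sub_eq_zero_of_minimal T
    (p := p.comp ((toWeakSpace ℝ E).symm : WeakSpace ℝ E →ₗ[ℝ] E)) ?_ (fun g x => hpρ g _)
    ⟨_, hz⟩ hQ hQconv hQT hmin ?_ (hQT g hz) hz
  · intro r
    have h1 : Convex ℝ {x | p x ≤ r} := by simpa using p.convex_setOf_sub_le 0 r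
    have h2 := h1.isClosed_image_toWeakSpace (isClosed_le hpc continuous_const)
    rwa [LinearEquiv.image_eq_preimage_symm] at h2
  · intro ε hε
    obtain ⟨c, hc, hcs⟩ := hsepE
    refine ⟨toWeakSpace ℝ E '' c, hc.image _, fun y hy => ?_⟩
    obtain ⟨y, hy', rfl⟩ := hQsub hy
    obtain ⟨d, hd, hdc⟩ := mem_closure_iff.1 (hcs hy') {d | p (y - d) < ε}
      (isOpen_lt (hpc.comp (continuous_const.sub continuous_id)) continuous_const)
      (by simpa using hε)
    exact ⟨_, ⟨d, hdc, rfl⟩, (le_of_lt hd : p (y - d) ≤ ε)⟩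

end RyllNardzewski

/-! ### Dominating functionals on the cone -/

section ConeRepresentation

open Set Filter Topology

variable {G : Type*} [Group G] {E : Type*} [AddCommGroup E] [Module ℝ E]

/-- In a representation of cobounded type on a cone, some positive functional dominates: every
functional is bounded in absolute value on the cone by a finite sum of its translates. -/
theorem IsCoboundedType.exists_nonneg [TopologicalSpace E] [IsTopologicalAddGroup E]
    [ContinuousSMul ℝ E] {ρ : G →* (E →L[ℝ] E)} {C : PointedCone ℝ E} (hρC : PreservesCone ρ C)
    (h : IsCoboundedType ρ C) :
    ∃ ψ : StrongDual ℝ E, (∀ x ∈ C, 0 ≤ ψ x) ∧ ∀ lam : StrongDual ℝ E, ∃ (n : ℕ) (g : Fin n → G),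
      ∀ x ∈ C, |lam x| ≤ ∑ i, ψ (ρ (g i) x) := by
  obtain ⟨φ, hφ⟩ := h
  have key : ∀ lam : StrongDual ℝ E, ∃ (n : ℕ) (g : Fin n → G),
      ∀ x ∈ C, |lam x| ≤ ∑ i, φ (ρ (g i) x) := by
    intro lam
    obtain ⟨n, g, h1, h2⟩ := hφ lam
    refine ⟨n, fun i => (g i)⁻¹, fun x hx => ?_⟩
    have h1' := h1 x hx
    have h2' := h2 x hx
    simp only [sum_apply, dualAct, ContinuousLinearMap.comp_apply, neg_apply] at h1' h2'
    exact abs_le'.2 ⟨h1', h2'⟩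
  -- The sum of translates dominating `|φ|` is nonnegative on `C` and dominates `φ`, so it can
  -- replace `φ`.
  obtain ⟨n, g, hg⟩ := key φ
  have happ : ∀ x, (∑ i, φ.comp (ρ (g i))) x = ∑ i, φ (ρ (g i) x) := fun x => by
    simp
  refine ⟨∑ i, φ.comp (ρ (g i)), fun x hx => ?_, fun lam => ?_⟩
  · rw [happ]
    exact (abs_nonneg _).trans (hg x hx)
  · obtain ⟨m, k, hk⟩ := key lam
    refine ⟨m, k, fun x hx => (hk x hx).trans (Finset.sum_le_sum fun i _ => ?_)⟩
    rw [happ]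
    exact (le_abs_self _).trans (hg _ (hρC _ x hx))

/-- The translates of a functional by an equicontinuous representation are dominated by a
continuous seminorm. -/
theorem exists_seminorm_forall_abs_le [UniformSpace E] [IsUniformAddGroup E] [ContinuousSMul ℝ E]
    (ρ : G →* (E →L[ℝ] E)) (hρ : Equicontinuous fun (g : G) (x : E) => ρ g x)
    (ψ : StrongDual ℝ E) :
    ∃ p : Seminorm ℝ E, Continuous p ∧ ∀ g x, |ψ (ρ g x)| ≤ p x := by
  have htfae := ((norm_withSeminorms ℝ ℝ).equicontinuous_TFAE
    fun g => (ψ.comp (ρ g) : E →ₗ[ℝ] ℝ)).out 1 3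
  have heq : Equicontinuous ((↑) ∘ fun g => (ψ.comp (ρ g) : E →ₗ[ℝ] ℝ) : G → E → ℝ) :=
    fun x U hU => hρ x _ (ψ.uniformContinuous hU)
  obtain ⟨p, hp, hle⟩ := htfae.1 heq 0
  exact ⟨p, hp, fun g x => hle g x⟩

/-- The average of the translates of a functional by an equicontinuous representation, with
respect to some summable family of positive weights, is a continuous functional. -/
theorem exists_average_strongDual [Countable G] [UniformSpace E] [IsUniformAddGroup E]
    [ContinuousSMul ℝ E] (ρ : G →* (E →L[ℝ] E))
    (hρ : Equicontinuous fun (g : G) (x : E) => ρ g x) (ψ : StrongDual ℝ E) :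
    ∃ (Φ : StrongDual ℝ E) (w : G → ℝ) (c : ℝ), (∀ g, 0 < w g) ∧ HasSum w c ∧ c ≤ 1 ∧
      ∀ x, HasSum (fun g => w g * ψ (ρ g x)) (Φ x) := by
  obtain ⟨p, hp, hle⟩ := exists_seminorm_forall_abs_le ρ hρ ψ
  have := Encodable.ofCountable G
  obtain ⟨w, hw, c, hc, hc1⟩ := posSumOfEncodable (zero_lt_one (α := ℝ)) G
  have hbound : ∀ x g, ‖w g * ψ (ρ g x)‖ ≤ w g * p x := fun x g => by
    rw [norm_mul, Real.norm_of_nonneg (hw g).le]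
    exact mul_le_mul_of_nonneg_left (hle g x) (hw g).le
  have hsum : ∀ x, Summable fun g => w g * ψ (ρ g x) := fun x =>
    Summable.of_norm_bounded (hc.summable.mul_right (p x)) (hbound x)
  let f : E →ₗ[ℝ] ℝ :=
    { toFun := fun x => ∑' g, w g * ψ (ρ g x)
      map_add' := fun x y => by
        rw [← (hsum x).tsum_add (hsum y)]
        simp only [map_add, mul_add]
      map_smul' := fun a x => by
        rw [RingHom.id_apply, smul_eq_mul, ← tsum_mul_left]
        simp only [map_smul, smul_eq_mul, mul_left_comm] }
  have hf : ∀ x, ‖f x‖ ≤ p x := fun x => by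
    refine (tsum_of_norm_bounded (hc.mul_right (p x)) (hbound x)).trans ?_
    nlinarith [apply_nonneg p x]
  have hfc : Continuous f := by
    refine continuous_of_continuousAt_zero f ?_
    rw [ContinuousAt, map_zero]
    refine squeeze_zero_norm hf ?_
    have := hp.tendsto 0
    rwa [map_zero] at this
  exact ⟨⟨f, hfc⟩, w, c, hw, hc, hc1, fun x => (hsum x).hasSum⟩

/-- If the sublevel sets of a strictly positive functional on a cone are weakly compact, then every
pointwise bounded family of positive functionals is uniformly dominated by it on the cone. -/
theorem exists_forall_le_mul_of_isCompact [TopologicalSpace E] {C : PointedCone ℝ E}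
    {Φ : StrongDual ℝ E} (hΦ : ∀ x ∈ C, x ≠ 0 → 0 < Φ x)
    (hcomp : ∀ b, IsCompact (toWeakSpace ℝ E '' {x | x ∈ C ∧ Φ x ≤ b}))
    {ι : Type*} {f : ι → StrongDual ℝ E} (hf : ∀ i, ∀ x ∈ C, 0 ≤ f i x)
    (hbdd : ∀ x, ∃ B, ∀ i, f i x ≤ B) : ∃ M, ∀ i, ∀ x ∈ C, f i x ≤ M * Φ x := by
  by_contra! h
  -- Gliding hump: a ratio above `4 ^ n` is rescaled so that the `Φ`-values are summable while the
  -- values of `f` blow up.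
  have hex : ∀ n : ℕ, ∃ i, ∃ y ∈ C, Φ y = (1 / 2) ^ n ∧ 2 ^ n ≤ f i y := by
    intro n
    obtain ⟨i, x, hx, hlt⟩ := h (4 ^ n)
    have hx0 : x ≠ 0 := by
      rintro rfl
      simp at hlt
    have hpos := hΦ x hx hx0
    refine ⟨i, ((1 / 2) ^ n / Φ x) • x, C.smul_mem (by positivity) hx, ?_, ?_⟩
    · rw [map_smul, smul_eq_mul]
      field_simp
    · rw [map_smul, smul_eq_mul]
      have h4 : (4 : ℝ) ^ n = 2 ^ n * 2 ^ n := by rw [← mul_pow]; norm_num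
      have h2 : (2 : ℝ) ^ n = (1 / 2) ^ n / Φ x * (4 ^ n * Φ x) := by
        rw [h4, div_pow, one_pow]
        field_simp
      rw [h2]
      exact mul_le_mul_of_nonneg_left hlt.le (by positivity)
  choose i y hyC hΦy hfy using hex
  set s : ℕ → E := fun N => ∑ n ∈ Finset.range N, y n with hs
  have hsmem : ∀ N, s N ∈ {x | x ∈ C ∧ Φ x ≤ 2} := fun N => by
    refine ⟨C.sum_mem fun n _ => hyC n, ?_⟩
    rw [hs, map_sum]
    simp only [hΦy]
    exact sum_geometric_two_le N
  obtain ⟨_, ⟨x, -, rfl⟩, hcl⟩ := (hcomp 2).exists_mapClusterPt (f := atTop)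
    (u := fun N => toWeakSpace ℝ E (s N))
    (tendsto_principal.2 (Eventually.of_forall fun N => mem_image_of_mem _ (hsmem N)))
  obtain ⟨B, hB⟩ := hbdd x
  -- All terms being positive, later partial sums keep the `n`-th hump, and the weak cluster point
  -- inherits the bound.
  have hlow : ∀ n, 2 ^ n ≤ f (i n) x := by
    intro n
    have hclosed : IsClosed {z : WeakSpace ℝ E | 2 ^ n ≤ f (i n) ((toWeakSpace ℝ E).symm z)} :=
      isClosed_le continuous_const (WeakSpace.continuous_eval _)
    have hev : ∀ᶠ N in atTop, toWeakSpace ℝ E (s N) ∈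
        {z : WeakSpace ℝ E | 2 ^ n ≤ f (i n) ((toWeakSpace ℝ E).symm z)} := by
      filter_upwards [eventually_gt_atTop n] with N hN
      rw [LinearEquiv.symm_apply_apply, hs, map_sum]
      exact (hfy n).trans (Finset.single_le_sum (f := fun m => f (i n) (y m))
        (fun m _ => hf _ _ (hyC m)) (Finset.mem_range.2 hN))
    have hmem := hclosed.mem_of_mapClusterPt hcl hev
    simpa using hmem
  obtain ⟨n, hn⟩ := pow_unbounded_of_one_lt B (one_lt_two (α := ℝ))
  linarith [hlow n, hB (i n)]

end ConeRepresentation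

/-! ### The fixed point in the cone -/

theorem mainTheorem2 {G : Type*} [Group G] [Countable G]
    {E : Type*} [AddCommGroup E] [Module ℝ E] [UniformSpace E] [IsUniformAddGroup E]
    [ContinuousSMul ℝ E] [LocallyConvexSpace ℝ E] [T2Space E]
    (C : PointedCone ℝ E) (hC_proper : (C : Set E) ∩ -(C : Set E) = {0})
    (hC_ne : (C : Set E) ≠ {0}) (hC_complete : IsWeaklyComplete (C : Set E))
    (ρ : G →* (E →L[ℝ] E)) (hρC : PreservesCone ρ C) (hρ_cobounded : IsCoboundedType ρ C)
    (hρ_equi : Equicontinuous fun (g : G) (x : E) => ρ g x) :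
    ∃ x ∈ C, x ≠ 0 ∧ ∀ g : G, ρ g x = x := by
  obtain ⟨ψ, hψ, hdom⟩ := hρ_cobounded.exists_nonneg hρC
  obtain ⟨p, -, hp⟩ := exists_seminorm_forall_abs_le ρ hρ_equi ψ
  obtain ⟨Φ, w, c, hw, hc, hc1, hΦ⟩ := exists_average_strongDual ρ hρ_equi ψ
  have hψΦ : ∀ g, ∀ x ∈ C, ψ (ρ g x) ≤ (w g)⁻¹ * Φ x := fun g x hx => by
    have := le_hasSum (hΦ x) g fun h _ => mul_nonneg (hw h).le (hψ _ (hρC h x hx))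
    rwa [le_inv_mul_iff₀ (hw g)]
  have hΦ0 : ∀ x ∈ C, 0 ≤ Φ x := fun x hx =>
    (hΦ x).nonneg fun g => mul_nonneg (hw g).le (hψ _ (hρC g x hx))
  have hdomΦ : ∀ lam : StrongDual ℝ E, ∃ d, 0 ≤ d ∧ ∀ x ∈ C, |lam x| ≤ d * Φ x := by
    intro lam
    obtain ⟨n, g, hg⟩ := hdom lam
    refine ⟨∑ i, (w (g i))⁻¹, Finset.sum_nonneg fun i _ => (inv_pos.2 (hw _)).le, fun x hx => ?_⟩
    rw [Finset.sum_mul]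
    exact (hg x hx).trans (Finset.sum_le_sum fun i _ => hψΦ _ x hx)
  have hΦpos : ∀ x ∈ C, x ≠ 0 → 0 < Φ x := by
    intro x hx hx0
    refine (hΦ0 x hx).lt_of_ne fun h0 => ?_
    obtain ⟨f, hf⟩ := exists_strongDual_ne hx0
    obtain ⟨d, -, hd⟩ := hdomΦ f
    have := hd x hx
    rw [← h0, mul_zero] at this
    exact hf (by rw [abs_nonpos_iff.1 this, map_zero])
  have hcompact : ∀ (K : Set E) (b : ℝ) (F : Set (WeakSpace ℝ E)), IsClosed F →
      K = {x | x ∈ C ∧ toWeakSpace ℝ E x ∈ F} → (∀ x ∈ K, Φ x ≤ b) →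
      IsCompact (toWeakSpace ℝ E '' K) := by
    intro K b F hF hK hb
    refine hC_complete.isCompact_image (fun x hx => (hK ▸ hx).1) ⟨F, hF, ?_⟩ fun lam => ?_
    · rw [hK]
      ext z
      constructor
      · rintro ⟨x, hx, rfl⟩
        exact ⟨⟨x, hx.1, rfl⟩, hx.2⟩
      · rintro ⟨⟨x, hx, rfl⟩, hz⟩
        exact ⟨x, ⟨hx, hz⟩, rfl⟩
    · obtain ⟨d, hd0, hd⟩ := hdomΦ lam
      exact ⟨d * b, fun x hx => (hd x (hK ▸ hx).1).trans
        (mul_le_mul_of_nonneg_left (hb x hx) hd0)⟩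
  obtain ⟨M₀, hM₀⟩ := exists_forall_le_mul_of_isCompact (f := fun g => ψ.comp (ρ g)) hΦpos
    (fun b => hcompact _ b {z | Φ ((toWeakSpace ℝ E).symm z) ≤ b}
      (isClosed_le (WeakSpace.continuous_eval Φ) continuous_const) rfl fun x hx => hx.2)
    (fun g x hx => hψ _ (hρC g x hx)) (fun x => ⟨p x, fun g => (le_abs_self _).trans (hp g x)⟩)
  -- The maximum ensures `M > 0`, so that `M⁻¹ * Φ x₀` is a positive lower bound.
  set M := max M₀ 1
  have hM1 : 1 ≤ M := le_max_right _ _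
  have hMpos : 0 < M := one_pos.trans_le hM1
  -- The bound on each translate of `ψ` is averaged; the total weight is at most 1.
  have hM : ∀ g, ∀ x ∈ C, Φ (ρ g x) ≤ M * Φ x := by
    intro g x hx
    have h1 : ∀ h, w h * ψ (ρ h (ρ g x)) ≤ w h * (M * Φ x) := fun h => by
      refine mul_le_mul_of_nonneg_left ?_ (hw h).le
      have := hM₀ (h * g) x hx
      simp only [ContinuousLinearMap.comp_apply, map_mul, mul_apply_eq_comp] at this
      exact this.trans (mul_le_mul_of_nonneg_right (le_max_left _ _) (hΦ0 x hx))
    have h2 := hasSum_le h1 (hΦ (ρ g x)) (hc.mul_right _)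
    have h3 := mul_le_mul_of_nonneg_right hc1 (mul_nonneg hMpos.le (hΦ0 x hx))
    linarith
  obtain ⟨x₀, hx₀, hx₀0⟩ : ∃ x ∈ C, x ≠ 0 := by
    by_contra! h
    exact hC_ne (Set.eq_singleton_iff_unique_mem.2 ⟨C.zero_mem, h⟩)
  have hinv : ∀ g x, ρ g⁻¹ (ρ g x) = x := fun g x => by
    rw [← mul_apply_eq_comp, ← map_mul, inv_mul_cancel, map_one]
    rfl
  have hΦx₀ := hΦpos x₀ hx₀ hx₀0
  let F : Set (WeakSpace ℝ E) := ⋂ g, {z | M⁻¹ * Φ x₀ ≤ Φ (ρ g ((toWeakSpace ℝ E).symm z))} ∩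
    {z | Φ (ρ g ((toWeakSpace ℝ E).symm z)) ≤ M * Φ x₀}
  have hF : IsClosed F := isClosed_iInter fun g =>
    (isClosed_le continuous_const (WeakSpace.continuous_eval (Φ.comp (ρ g)))).inter
      (isClosed_le (WeakSpace.continuous_eval (Φ.comp (ρ g))) continuous_const)
  -- Bounding the whole orbit makes `K` invariant. The lower bound holds at `x₀` by applying `hM` to
  -- `g⁻¹`, and it excludes 0.
  set K : Set E := {x | x ∈ C ∧ ∀ g, M⁻¹ * Φ x₀ ≤ Φ (ρ g x) ∧ Φ (ρ g x) ≤ M * Φ x₀} with hK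
  obtain ⟨x, hx, hfix⟩ := exists_fixed_point_of_isCompact_weak ρ hρ_equi (K := K)
    ⟨x₀, hx₀, fun g => ⟨by
      rw [inv_mul_le_iff₀ hMpos]
      have := hM g⁻¹ (ρ g x₀) (hρC g x₀ hx₀)
      rwa [hinv] at this, hM g x₀ hx₀⟩⟩
    (hcompact K (M * Φ x₀) F hF (by
        ext x
        simp [hK, F])
      fun x hx => by simpa using (hx.2 1).2)
    (by
      rintro x ⟨hx, hx'⟩ y ⟨hy, hy'⟩ a b ha hb hab
      refine ⟨C.add_mem (C.smul_mem ha hx) (C.smul_mem hb hy), fun g => ?_⟩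
      have hlin : Φ (ρ g (a • x + b • y)) = a • Φ (ρ g x) + b • Φ (ρ g y) := by
        simp only [map_add, map_smul]
      rw [hlin]
      exact convex_Icc _ _ (hx' g) (hy' g) ha hb hab)
    (fun g x hx => ⟨hρC g x hx.1, fun h => by
      have := hx.2 (h * g)
      rwa [map_mul, mul_apply_eq_comp] at this⟩)
  refine ⟨x, hx.1, ?_, hfix⟩
  rintro rfl
  have := (hx.2 1).1
  rw [map_zero, map_zero] at this
  exact absurd this (not_le.2 (by positivity))
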